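/- Notation. For $t,s,h>0$ and $f\in C^\infty(\mathbf R^d)$ put $$\|f\|_{\mathcal S_{t,h}^s}=\sup_{\alpha,\beta\in\mathbf N^d,\ x\in\mathbf R^d}\frac{|x^\alpha\partial^\beta f(x)|}{h^{|\alpha+\beta|}\,\alpha!^t\,\beta!^s},$$ and let $\Sigma_t^s(\mathbf R^d)$ be the space of all $f\in C^\infty(\mathbf R^d)$ with $\|f\|_{\mathcal S_{t,h}^s}<\infty$ for every $h>0$, with the topology defined by these norms. Let $(\Sigma_t^s)'(\mathbf R^d)$ be the space of continuous conjugate linear functionals $\varphi\mapsto(u,\varphi)$ on $\Sigma_t^s(\mathbf R^d)$; a function $a$ on $\mathbf R^d$ belongs to it through $(a,\varphi)=\int_{\mathbf R^d} a(x)\overline{\varphi(x)}\,dx$, if these integrals converge absolutely and define a continuous functional. For $\psi\in\Sigma_t^s(\mathbf R^d)\setminus 0$ and $u\in(\Sigma_t^s)'(\mathbf R^d)$ let $$V_\psi u(x,\xi)=(2\pi)^{-d/2}\,\bigl(u,\ e^{i\langle\cdot,\xi\rangle}\psi(\cdot-x)\bigr),\qquad x,\xi\in\mathbf R^d.$$ The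 wave front set $\mathrm{WF}^{t,s}(u)$, with respect to the window $\psi$, is the set of all $(x_0,\xi_0)\in(\mathbf R^d\times\mathbf R^d)\setminus 0$ for which there is no open set $U\subseteq(\mathbf R^d\times\mathbf R^d)\setminus 0$ containing $(x_0,\xi_0)$ such that $$\sup_{\lambda>0,\ (x,\xi)\in U}e^{r\lambda}\,|V_\psi u(\lambda^t x,\lambda^s\xi)|<\infty\qquad\text{for all } r>0.$$ Proposition. Let $0<t\le 1$, $s>0$, $s+t>1$ and $z\in\mathbf C^d$, and write $\langle x,z\rangle=\sum_{j=1}^d x_jz_j$ for $x\in\mathbf R^d$. Then the function $x\mapsto e^{\langle x,z\rangle}$ belongs to $(\Sigma_t^s)'(\mathbf R^d)$, and for every window $\psi\in\Sigma_t^s(\mathbf R^d)\setminus 0$ $$\mathrm{WF}^{t,s}\bigl(e^{\langle\cdot,z\rangle}\bigr)=(\mathbf R^d\setminus 0)\times\{0\}.$$ -/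

import Mathlib

open scoped ContDiff ENNReal NNReal

namespace GelfandShilov

/-- Euclidean space `ℝ^d`. -/
abbrev Rd (d : ℕ) := EuclideanSpace ℝ (Fin d)

/-- The partial derivative `∂_j f`. -/
noncomputable def partialDeriv {d : ℕ} (j : Fin d) (f : Rd d → ℂ) :
    Rd d → ℂ :=
  fun x => fderiv ℝ f x (EuclideanSpace.single j 1)

/-- The partial derivative `∂^β f = ∂_1^{β_1} ⋯ ∂_d^{β_d} f` for a multi-index `β ∈ ℕ^d`. -/
noncomputable def multiDeriv {d : ℕ} (β : Fin d → ℕ) (f : Rd d → ℂ) :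
    Rd d → ℂ :=
  (List.finRange d).foldr (fun j g => (partialDeriv j)^[β j] g) f

/-- The monomial `x^α`. -/
noncomputable def monomial {d : ℕ} (α : Fin d → ℕ) (x : Rd d) : ℝ :=
  ∏ j, x j ^ α j

/-- The length `|α|` of a multi-index. -/
def length {d : ℕ} (α : Fin d → ℕ) : ℕ := ∑ j, α j

/-- The factorial `α!` of a multi-index. -/
def multiFactorial {d : ℕ} (α : Fin d → ℕ) : ℕ := ∏ j, (α j).factorial

/-- The norm of `𝓢_{t,h}^s(ℝ^d)`, the supremum over all `α, β ∈ ℕ^d` and `x ∈ ℝ^d` of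
`|x^α ∂^β f(x)| / (h^{|α + β|} α!^t β!^s)`, as an extended nonnegative number. -/
noncomputable def gsNorm {d : ℕ} (t s h : ℝ) (f : Rd d → ℂ) : ℝ≥0∞ :=
  ⨆ (α : Fin d → ℕ) (β : Fin d → ℕ) (x : Rd d),
    ENNReal.ofReal (‖(monomial α x : ℂ) * multiDeriv β f x‖ /
      (h ^ (length α + length β) * (multiFactorial α : ℝ) ^ t * (multiFactorial β : ℝ) ^ s))

variable {d : ℕ}

/-- Auxiliary: the iterated derivative `∂_{j_1} ⋯ ∂_{j_n} f` along a word `[j_1, …, j_n]`. -/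
noncomputable def wordDeriv (L : List (Fin d)) (f : Rd d → ℂ) : Rd d → ℂ := L.foldr partialDeriv f

/-- Auxiliary: the word `1 … 1 2 … 2 ⋯ d … d` with `β_j` letters `j`. -/
def word (β : Fin d → ℕ) : List (Fin d) :=
  (List.finRange d).flatMap fun j => List.replicate (β j) j

theorem multiDeriv_eq_wordDeriv (β : Fin d → ℕ) (f : Rd d → ℂ) :
    multiDeriv β f = wordDeriv (word β) f := by
  have h : ∀ l : List (Fin d), l.foldr (fun j g => (partialDeriv j)^[β j] g) f =
      wordDeriv (l.flatMap fun j => List.replicate (β j) j) f := by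
    intro l
    induction l with
    | nil => rfl
    | cons a l ih =>
      rw [List.foldr_cons, ih, List.flatMap_cons]
      unfold wordDeriv
      rw [List.foldr_append]
      generalize List.foldr partialDeriv f _ = g
      generalize β a = n
      induction n with
      | zero => rfl
      | succ n ihn => rw [Function.iterate_succ_apply', ihn, List.replicate_succ, List.foldr_cons]
  exact h _

theorem count_word (β : Fin d → ℕ) (j : Fin d) : (word β).count j = β j := by
  unfold word
  rw [List.count_flatMap]
  simp only [Function.comp_def, List.count_replicate]
  rw [← Fin.sum_univ_def]
  simp

theorem iteratedFDeriv_word {f : Rd d → ℂ} (hf : ContDiff ℝ ∞ f) (L : List (Fin d)) (x : Rd d) :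
    iteratedFDeriv ℝ L.length f x (fun i => EuclideanSpace.single (L.get i) 1) =
      wordDeriv L f x := by
  induction L generalizing x with
  | nil => simp [wordDeriv]
  | cons a L ih =>
    have hd : DifferentiableAt ℝ (iteratedFDeriv ℝ L.length f) x :=
      (hf.differentiable_iteratedFDeriv (by exact_mod_cast ENat.natCast_lt_top _)) x
    have h1 : wordDeriv (a :: L) f x = fderiv ℝ (wordDeriv L f) x (EuclideanSpace.single a 1) := rfl
    have h2 : wordDeriv L f = fun y => iteratedFDeriv ℝ L.length f y
        (fun i => EuclideanSpace.single (L.get i) 1) := by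
      ext y; rw [ih]
    rw [h1, h2]
    simp only [List.length_cons]
    rw [iteratedFDeriv_succ_apply_left, fderiv_continuousMultilinear_apply_const_apply hd]
    rfl

theorem contDiff_partialDeriv {f : Rd d → ℂ} (hf : ContDiff ℝ ∞ f) (j : Fin d) :
    ContDiff ℝ ∞ (partialDeriv j f) :=
  (hf.fderiv_right (m := ∞) le_rfl).clm_apply contDiff_const

theorem contDiff_wordDeriv {f : Rd d → ℂ} (hf : ContDiff ℝ ∞ f) (L : List (Fin d)) :
    ContDiff ℝ ∞ (wordDeriv L f) := by
  induction L with
  | nil => exact hf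
  | cons a L ih => exact contDiff_partialDeriv ih a

theorem partialDeriv_comm {f : Rd d → ℂ} (hf : ContDiff ℝ ∞ f) (i j : Fin d) :
    partialDeriv i (partialDeriv j f) = partialDeriv j (partialDeriv i f) := by
  have hd : Differentiable ℝ (fderiv ℝ f) :=
    (hf.fderiv_right (m := ∞) le_rfl).differentiable (by simp)
  ext x
  unfold partialDeriv
  rw [fderiv_clm_apply (hd x) (differentiableAt_const _),
    fderiv_clm_apply (hd x) (differentiableAt_const _)]
  have := (hf.contDiffAt (x := x)).isSymmSndFDerivAt
    (by rw [minSmoothness_of_isRCLikeNormedField]; exact WithTop.coe_le_coe.2 le_top)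
  simpa using this _ _

theorem wordDeriv_perm {f : Rd d → ℂ} (hf : ContDiff ℝ ∞ f) {L M : List (Fin d)} (h : L.Perm M) :
    wordDeriv L f = wordDeriv M f := by
  induction h with
  | nil => rfl
  | cons a _ ih => exact congrArg (partialDeriv a) ih
  | swap a b l => exact partialDeriv_comm (contDiff_wordDeriv hf l) b a
  | trans _ _ h1 h2 => exact h1.trans h2

theorem wordDeriv_eq_multiDeriv {f : Rd d → ℂ} (hf : ContDiff ℝ ∞ f) (L : List (Fin d)) :
    wordDeriv L f = multiDeriv (fun j => L.count j) f := by
  rw [multiDeriv_eq_wordDeriv]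
  refine wordDeriv_perm hf ?_
  rw [List.perm_iff_count]
  intro a
  rw [count_word]

theorem length_word (β : Fin d → ℕ) : (word β).length = length β := by
  unfold word
  rw [List.length_flatMap]
  simp only [List.length_replicate]
  rw [← Fin.sum_univ_def]; rfl


theorem gsNorm_lt_top_iff {t s h : ℝ} (hh : 0 < h) (f : Rd d → ℂ) :
    gsNorm t s h f < ⊤ ↔ ∃ C : ℝ, 0 ≤ C ∧ ∀ (α β : Fin d → ℕ) (x : Rd d),
      ‖(monomial α x : ℂ) * multiDeriv β f x‖ ≤
        C * (h ^ (length α + length β) * (multiFactorial α : ℝ) ^ t *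
          (multiFactorial β : ℝ) ^ s) := by
  have hpos : ∀ α β : Fin d → ℕ, 0 < h ^ (length α + length β) * (multiFactorial α : ℝ) ^ t *
          (multiFactorial β : ℝ) ^ s := by
    intro α β
    have h1 : (0 : ℝ) < multiFactorial α := by
      unfold multiFactorial; exact_mod_cast Finset.prod_pos fun j _ => Nat.factorial_pos _
    have h2 : (0 : ℝ) < multiFactorial β := by
      unfold multiFactorial; exact_mod_cast Finset.prod_pos fun j _ => Nat.factorial_pos _
    positivity
  constructor
  · intro hlt
    refine ⟨(gsNorm t s h f).toReal, ENNReal.toReal_nonneg, fun α β x => ?_⟩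
    rw [← div_le_iff₀ (hpos α β)]
    rw [← ENNReal.ofReal_le_iff_le_toReal hlt.ne]
    exact le_iSup_of_le α (le_iSup_of_le β (le_iSup_of_le x le_rfl))
  · rintro ⟨C, hC, hb⟩
    refine lt_of_le_of_lt (iSup_le fun α => iSup_le fun β => iSup_le fun x => ?_)
      (ENNReal.ofReal_lt_top (r := C))
    refine ENNReal.ofReal_le_ofReal ?_
    rw [div_le_iff₀ (hpos α β)]
    exact hb α β x

/-- Auxiliary: a coordinate-free form of the estimates that define `Σ_t^s(ℝ^d)`. -/
def NormBound (t s : ℝ) (f : Rd d → ℂ) : Prop :=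
  ∀ h : ℝ, 0 < h → ∃ C : ℝ, 0 ≤ C ∧ ∀ (k n : ℕ) (x : Rd d),
    ‖x‖ ^ k * ‖iteratedFDeriv ℝ n f x‖ ≤
      C * (h ^ (k + n) * (k.factorial : ℝ) ^ t * (n.factorial : ℝ) ^ s)

theorem multiFactorial_le (α : Fin d → ℕ) : multiFactorial α ≤ (length α).factorial :=
  Nat.le_of_dvd (Nat.factorial_pos _) (Nat.prod_factorial_dvd_factorial_sum _ _)

theorem factorial_le (α : Fin d → ℕ) :
    (length α).factorial ≤ d ^ length α * multiFactorial α := by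
  have h := Nat.multinomial_spec Finset.univ α
  have h2 : Nat.multinomial Finset.univ α ≤ d ^ length α := by
    have h3 := Finset.sum_pow_eq_sum_piAntidiag (Finset.univ : Finset (Fin d))
      (fun _ => (1 : ℕ)) (length α)
    simp only [Finset.sum_const, Finset.card_univ, Fintype.card_fin, smul_eq_mul, mul_one,
      one_pow, Finset.prod_const_one] at h3
    rw [h3]
    exact Finset.single_le_sum (f := fun k => Nat.multinomial Finset.univ k)
      (fun _ _ => Nat.zero_le _) (by simp [length])
  unfold length multiFactorial at *
  rw [← h, mul_comm]
  exact Nat.mul_le_mul_right _ h2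

theorem length_count (L : List (Fin d)) : length (fun j => L.count j) = L.length := by
  unfold length
  have := Multiset.sum_count_eq_card (s := Finset.univ) (m := (L : Multiset (Fin d)))
    (fun a _ => Finset.mem_univ a)
  simpa using this

theorem norm_pow_le (x : Rd d) (k : ℕ) :
    ‖x‖ ^ k ≤ ∑ p : Fin k → Fin d, |monomial (fun j => (List.ofFn p).count j) x| := by
  have h1 : ‖x‖ ≤ ∑ j, |x j| := by
    calc ‖x‖ = ‖∑ j, x j • EuclideanSpace.single j (1 : ℝ)‖ := by
          congr 1
          ext i
          simp [Finset.sum_apply, Pi.single_apply]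
      _ ≤ ∑ j, ‖x j • EuclideanSpace.single j (1 : ℝ)‖ := norm_sum_le _ _
      _ = ∑ j, |x j| := by simp [norm_smul]
  calc ‖x‖ ^ k ≤ (∑ j, |x j|) ^ k := by gcongr
    _ = ∏ _i : Fin k, ∑ j, |x j| := by simp
    _ = ∑ p : Fin k → Fin d, ∏ i, |x (p i)| := by
        rw [Finset.prod_univ_sum]; simp
    _ = _ := by
        refine Finset.sum_congr rfl fun p _ => ?_
        unfold monomial
        rw [Finset.abs_prod]
        simp only [abs_pow]
        have hL : ∀ L : List (Fin d), (L.map fun j => |x j|).prod = ∏ j, |x j| ^ L.count j := by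
          intro L
          induction L with
          | nil => simp
          | cons a L ih =>
            simp only [List.map_cons, List.prod_cons, ih, List.count_cons, pow_add,
              Finset.prod_mul_distrib]
            rw [mul_comm]
            congr 1
            rw [Finset.prod_eq_single a]
            · simp
            · intro b _ hb
              simp [Ne.symm hb]
            · simp
        rw [← hL, ← List.prod_ofFn, List.map_ofFn]
        rfl

theorem norm_iteratedFDeriv_le {f : Rd d → ℂ} (hf : ContDiff ℝ ∞ f) (n : ℕ) (x : Rd d) :
    ‖iteratedFDeriv ℝ n f x‖ ≤
      ∑ p : Fin n → Fin d, ‖multiDeriv (fun j => (List.ofFn p).count j) f x‖ := by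
  have key : ∀ p : Fin n → Fin d, iteratedFDeriv ℝ n f x
      (fun i => EuclideanSpace.single (p i) 1) =
        multiDeriv (fun j => (List.ofFn p).count j) f x := by
    intro p
    rw [← wordDeriv_eq_multiDeriv hf, ← iteratedFDeriv_word hf]
    have : ∀ (m : ℕ) (hm : m = n), iteratedFDeriv ℝ n f x
      (fun i => EuclideanSpace.single (p i) 1) = iteratedFDeriv ℝ m f x
      (fun i => EuclideanSpace.single (p (Fin.cast hm i)) 1) := by
      rintro m rfl; rfl
    rw [this _ (List.length_ofFn (f := p))]
    congr 1
    ext1 i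
    congr 1
    simp [Fin.cast]
  refine ContinuousMultilinearMap.opNorm_le_bound (by positivity) fun m => ?_
  have hm : m = fun i => ∑ j, m i j • EuclideanSpace.single j (1 : ℝ) := by
    ext i l
    simp [Finset.sum_apply, Pi.single_apply]
  conv_lhs => rw [hm]
  rw [ContinuousMultilinearMap.map_sum, Finset.sum_mul]
  refine (norm_sum_le _ _).trans (Finset.sum_le_sum fun p _ => ?_)
  rw [ContinuousMultilinearMap.map_smul_univ, norm_smul, key, mul_comm]
  refine mul_le_mul_of_nonneg_left ?_ (norm_nonneg _)
  rw [norm_prod]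
  exact Finset.prod_le_prod (fun _ _ => norm_nonneg _) fun i _ =>
    PiLp.norm_apply_le (m i) (p i)

theorem abs_monomial_le (α : Fin d → ℕ) (x : Rd d) : |monomial α x| ≤ ‖x‖ ^ length α := by
  unfold monomial length
  rw [Finset.abs_prod, ← Finset.prod_pow_eq_pow_sum]
  simp only [abs_pow]
  refine Finset.prod_le_prod (fun _ _ => by positivity) fun j _ => ?_
  gcongr
  exact PiLp.norm_apply_le x j

theorem norm_multiDeriv_le {f : Rd d → ℂ} (hf : ContDiff ℝ ∞ f) (β : Fin d → ℕ) (x : Rd d) :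
    ‖multiDeriv β f x‖ ≤ ‖iteratedFDeriv ℝ (length β) f x‖ := by
  rw [multiDeriv_eq_wordDeriv, ← iteratedFDeriv_word hf, ← length_word β]
  refine (ContinuousMultilinearMap.le_opNorm _ _).trans ?_
  simp

theorem normBound_of_gsNorm {t s : ℝ} (ht : 0 ≤ t) (hs : 0 ≤ s) {f : Rd d → ℂ}
    (hf : ContDiff ℝ ∞ f) (H : ∀ h : ℝ, 0 < h → gsNorm t s h f < ⊤) : NormBound t s f := by
  intro h hh
  have hD : (0 : ℝ) < d + 1 := by positivity
  have hh' : 0 < h / (d + 1) := by positivity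
  obtain ⟨C, hC, hb⟩ := (gsNorm_lt_top_iff hh' f).1 (H _ hh')
  refine ⟨C, hC, fun k n x => ?_⟩
  have hterm : ∀ (p : Fin k → Fin d) (q : Fin n → Fin d),
      |monomial (fun j => (List.ofFn p).count j) x| *
        ‖multiDeriv (fun j => (List.ofFn q).count j) f x‖ ≤
      C * ((h / (d + 1)) ^ (k + n) * (k.factorial : ℝ) ^ t * (n.factorial : ℝ) ^ s) := by
    intro p q
    have h1 := hb (fun j => (List.ofFn p).count j) (fun j => (List.ofFn q).count j) x
    have h2 := multiFactorial_le (fun j => (List.ofFn p).count j)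
    have h3 := multiFactorial_le (fun j => (List.ofFn q).count j)
    rw [length_count, List.length_ofFn] at h2 h3
    rw [norm_mul, Complex.norm_real, Real.norm_eq_abs, length_count, length_count,
      List.length_ofFn, List.length_ofFn] at h1
    refine h1.trans ?_
    gcongr
  calc ‖x‖ ^ k * ‖iteratedFDeriv ℝ n f x‖
      ≤ (∑ p : Fin k → Fin d, |monomial (fun j => (List.ofFn p).count j) x|) *
        ∑ q : Fin n → Fin d, ‖multiDeriv (fun j => (List.ofFn q).count j) f x‖ :=
        mul_le_mul (norm_pow_le x k) (norm_iteratedFDeriv_le hf n x) (norm_nonneg _)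
          (by positivity)
    _ ≤ ∑ _p : Fin k → Fin d, ∑ _q : Fin n → Fin d,
        C * ((h / (d + 1)) ^ (k + n) * (k.factorial : ℝ) ^ t * (n.factorial : ℝ) ^ s) := by
        rw [Finset.sum_mul_sum]
        exact Finset.sum_le_sum fun p _ => Finset.sum_le_sum fun q _ => hterm p q
    _ = C * ((d * (h / (d + 1))) ^ (k + n) * (k.factorial : ℝ) ^ t * (n.factorial : ℝ) ^ s) := by
        simp only [Finset.sum_const, Finset.card_univ, Fintype.card_pi, Fintype.card_fin,
          Finset.prod_const, nsmul_eq_mul, Nat.cast_pow]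
        rw [mul_pow, pow_add (d : ℝ)]
        ring
    _ ≤ _ := by
        have : d * (h / (d + 1)) ≤ h := by
          rw [mul_div_assoc', div_le_iff₀ hD]
          nlinarith
        gcongr

theorem gsNorm_of_normBound {t s : ℝ} (ht : 0 ≤ t) (hs : 0 ≤ s) {f : Rd d → ℂ}
    (hf : ContDiff ℝ ∞ f) (H : NormBound t s f) (h : ℝ) (hh : 0 < h) : gsNorm t s h f < ⊤ := by
  rw [gsNorm_lt_top_iff hh]
  have hD : (1 : ℝ) ≤ d + 1 := by simp
  have hA : (1 : ℝ) ≤ (d + 1 : ℝ) ^ t := Real.one_le_rpow hD ht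
  have hB : (1 : ℝ) ≤ (d + 1 : ℝ) ^ s := Real.one_le_rpow hD hs
  set A := (d + 1 : ℝ) ^ t with hAdef
  set B := (d + 1 : ℝ) ^ s with hBdef
  have hA0 : 0 < A := by linarith
  have hB0 : 0 < B := by linarith
  obtain ⟨C, hC, hb⟩ := H (h / (A * B)) (by positivity)
  refine ⟨C, hC, fun α β x => ?_⟩
  have hfac : ∀ (u : ℝ) (_ : 0 ≤ u) (γ : Fin d → ℕ), ((length γ).factorial : ℝ) ^ u ≤
      ((d + 1 : ℝ) ^ u) ^ length γ * (multiFactorial γ : ℝ) ^ u := by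
    intro u hu γ
    have h1 : ((length γ).factorial : ℝ) ≤ (d + 1 : ℝ) ^ length γ * multiFactorial γ := by
      calc ((length γ).factorial : ℝ) ≤ (d : ℝ) ^ length γ * multiFactorial γ := by
            exact_mod_cast factorial_le γ
        _ ≤ _ := by gcongr; linarith
    calc ((length γ).factorial : ℝ) ^ u ≤ ((d + 1 : ℝ) ^ length γ * multiFactorial γ) ^ u := by
          gcongr
      _ = _ := by
          rw [Real.mul_rpow (by positivity) (by positivity), ← Real.rpow_natCast,
            ← Real.rpow_mul (by positivity), mul_comm (length γ : ℝ), Real.rpow_mul (by positivity),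
            Real.rpow_natCast]
  have hpw : (h / (A * B)) ^ (length α + length β) * A ^ length α * B ^ length β ≤
      h ^ (length α + length β) := by
    have e1 : A ^ length α ≤ A ^ (length α + length β) := pow_le_pow_right₀ hA (by omega)
    have e2 : B ^ length β ≤ B ^ (length α + length β) := pow_le_pow_right₀ hB (by omega)
    calc _ ≤ (h / (A * B)) ^ (length α + length β) * A ^ (length α + length β) *
          B ^ (length α + length β) := by gcongr
      _ = _ := by rw [← mul_pow, ← mul_pow]; congr 1; field_simp
  rw [norm_mul, Complex.norm_real, Real.norm_eq_abs]
  calc |monomial α x| * ‖multiDeriv β f x‖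
      ≤ ‖x‖ ^ length α * ‖iteratedFDeriv ℝ (length β) f x‖ :=
        mul_le_mul (abs_monomial_le α x) (norm_multiDeriv_le hf β x) (norm_nonneg _)
          (by positivity)
    _ ≤ _ := hb _ _ x
    _ ≤ C * ((h / (A * B)) ^ (length α + length β) * (A ^ length α * (multiFactorial α : ℝ) ^ t) *
        (B ^ length β * (multiFactorial β : ℝ) ^ s)) := by
        gcongr
        · exact hfac t ht α
        · exact hfac s hs β
    _ = C * (((h / (A * B)) ^ (length α + length β) * A ^ length α * B ^ length β) *
        (multiFactorial α : ℝ) ^ t * (multiFactorial β : ℝ) ^ s) := by ring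
    _ ≤ _ := by gcongr

/-- Powers are dominated by factorials. -/
theorem pow_le_factorial (a : ℝ) (ha : 0 ≤ a) {h u : ℝ} (hh : 0 < h) (hu : 0 < u) :
    ∃ C : ℝ, 0 ≤ C ∧ ∀ n : ℕ, a ^ n ≤ C * (h ^ n * (n.factorial : ℝ) ^ u) := by
  set b := (a / h) ^ (1 / u) with hb
  have hb0 : 0 ≤ b := by positivity
  have hbu : b ^ u = a / h := by
    rw [hb, ← Real.rpow_mul (by positivity), one_div_mul_cancel hu.ne', Real.rpow_one]
  refine ⟨(Real.exp b) ^ u, by positivity, fun n => ?_⟩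
  have h1 : b ^ n ≤ Real.exp b * n.factorial := by
    have := Real.pow_div_factorial_le_exp b hb0 n
    rwa [div_le_iff₀ (by positivity)] at this
  have h2 : (b ^ n) ^ u ≤ (Real.exp b * n.factorial) ^ u := by gcongr
  rw [Real.mul_rpow (by positivity) (by positivity), ← Real.rpow_natCast, ← Real.rpow_mul hb0,
    mul_comm (n : ℝ), Real.rpow_mul hb0, hbu, Real.rpow_natCast, div_pow,
    div_le_iff₀ (by positivity)] at h2
  calc a ^ n ≤ _ := h2
    _ = _ := by ring

theorem NormBound.comp_sub {t s : ℝ} (ht : 0 < t) {f : Rd d → ℂ} (H : NormBound t s f) (y : Rd d) :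
    NormBound t s (fun x => f (x - y)) := by
  intro h hh
  have hh' : 0 < h / 2 := by positivity
  obtain ⟨C, hC, hb⟩ := H (h / 2) hh'
  obtain ⟨C', hC', hb'⟩ := pow_le_factorial ‖y‖ (norm_nonneg y) hh' ht
  refine ⟨C + C' * C, by positivity, fun k n x => ?_⟩
  rw [iteratedFDeriv_comp_sub]
  have h1 : ‖x‖ ^ k ≤ 2 ^ k * (‖x - y‖ ^ k + ‖y‖ ^ k) := by
    have e : ‖x‖ ≤ ‖x - y‖ + ‖y‖ := by simpa using norm_add_le (x - y) y
    calc ‖x‖ ^ k ≤ (‖x - y‖ + ‖y‖) ^ k := by gcongr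
      _ ≤ 2 ^ (k - 1) * (‖x - y‖ ^ k + ‖y‖ ^ k) :=
        _root_.add_pow_le (norm_nonneg _) (norm_nonneg _) k
      _ ≤ _ := by gcongr <;> norm_num
  have h2 := hb k n (x - y)
  have h3 := hb 0 n (x - y)
  simp only [pow_zero, one_mul, zero_add, Nat.factorial_zero, Nat.cast_one, Real.one_rpow,
    mul_one] at h3
  calc ‖x‖ ^ k * ‖iteratedFDeriv ℝ n f (x - y)‖
      ≤ 2 ^ k * (‖x - y‖ ^ k + ‖y‖ ^ k) * ‖iteratedFDeriv ℝ n f (x - y)‖ := by gcongr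
    _ = 2 ^ k * (‖x - y‖ ^ k * ‖iteratedFDeriv ℝ n f (x - y)‖ +
        ‖y‖ ^ k * ‖iteratedFDeriv ℝ n f (x - y)‖) := by ring
    _ ≤ 2 ^ k * (C * ((h / 2) ^ (k + n) * (k.factorial : ℝ) ^ t * (n.factorial : ℝ) ^ s) +
        (C' * ((h / 2) ^ k * (k.factorial : ℝ) ^ t)) *
          (C * ((h / 2) ^ n * (n.factorial : ℝ) ^ s))) := by
        gcongr
        exact hb' k
    _ = (C + C' * C) * (2 ^ k * (h / 2) ^ (k + n) * (k.factorial : ℝ) ^ t *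
          (n.factorial : ℝ) ^ s) := by rw [pow_add]; ring
    _ ≤ (C + C' * C) * (h ^ (k + n) * (k.factorial : ℝ) ^ t * (n.factorial : ℝ) ^ s) := by
        gcongr
        calc (2 : ℝ) ^ k * (h / 2) ^ (k + n) ≤ 2 ^ (k + n) * (h / 2) ^ (k + n) := by
              gcongr
              · norm_num
              · omega
          _ = h ^ (k + n) := by rw [← mul_pow]; congr 1; ring

theorem norm_iteratedFDeriv_character_le (ξ x : Rd d) (n : ℕ) :
    ‖iteratedFDeriv ℝ n (fun y : Rd d => Complex.exp (Complex.I * (inner ℝ y ξ : ℝ))) x‖ ≤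
      ‖ξ‖ ^ n := by
  have hd : ∀ n : ℕ, iteratedDeriv n (fun r : ℝ => Complex.exp (Complex.I * r)) =
      fun r : ℝ => Complex.I ^ n * Complex.exp (Complex.I * r) := by
    intro n
    induction n with
    | zero => ext r; simp
    | succ n ih =>
      rw [iteratedDeriv_succ, ih]
      ext r
      have h1 : HasDerivAt (fun r : ℝ => Complex.exp (Complex.I * r))
          (Complex.exp (Complex.I * r) * (Complex.I * 1)) r :=
        ((Complex.ofRealCLM.hasDerivAt (x := r)).const_mul Complex.I).cexp
      rw [(h1.const_mul (Complex.I ^ n)).deriv]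
      ring
  have hc : ContDiff ℝ ∞ (fun r : ℝ => Complex.exp (Complex.I * r)) :=
    (contDiff_const.mul Complex.ofRealCLM.contDiff).cexp
  have he : (fun y : Rd d => Complex.exp (Complex.I * (inner ℝ y ξ : ℝ))) =
      (fun r : ℝ => Complex.exp (Complex.I * r)) ∘ (innerSL ℝ ξ) := by
    ext y
    simp [real_inner_comm]
  rw [he, ContinuousLinearMap.iteratedFDeriv_comp_right _ hc x
    (i := n) (by exact_mod_cast le_top)]
  refine (ContinuousMultilinearMap.norm_compContinuousLinearMap_le _ _).trans ?_
  rw [norm_iteratedFDeriv_eq_norm_iteratedDeriv, hd]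
  simp [Complex.norm_exp]

theorem contDiff_character (ξ : Rd d) :
    ContDiff ℝ ∞ (fun y : Rd d => Complex.exp (Complex.I * (inner ℝ y ξ : ℝ))) :=
  (contDiff_const.mul (Complex.ofRealCLM.contDiff.comp (contDiff_id.inner ℝ contDiff_const))).cexp

theorem NormBound.modulation {t s : ℝ} (hs : 0 < s) {f : Rd d → ℂ}
    (hf : ContDiff ℝ ∞ f) (H : NormBound t s f) (ξ : Rd d) :
    NormBound t s (fun x => Complex.exp (Complex.I * (inner ℝ x ξ : ℝ)) * f x) := by
  intro h hh
  have hh' : 0 < h / 2 := by positivity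
  obtain ⟨C, hC, hb⟩ := H (h / 2) hh'
  obtain ⟨C', hC', hb'⟩ := pow_le_factorial ‖ξ‖ (norm_nonneg ξ) hh' hs
  refine ⟨C' * C, by positivity, fun k n x => ?_⟩
  have h1 := norm_iteratedFDeriv_mul_le (contDiff_character ξ) hf x (n := n)
    (by exact_mod_cast le_top)
  have hterm : ∀ i ∈ Finset.range (n + 1), ‖x‖ ^ k * ((n.choose i : ℝ) *
      ‖iteratedFDeriv ℝ i (fun y : Rd d => Complex.exp (Complex.I * (inner ℝ y ξ : ℝ))) x‖ *
      ‖iteratedFDeriv ℝ (n - i) f x‖) ≤ (n.choose i : ℝ) * (C' * C *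
        ((h / 2) ^ (k + n) * (k.factorial : ℝ) ^ t * (n.factorial : ℝ) ^ s)) := by
    intro i hi
    have hi' : i ≤ n := by simpa [Nat.lt_succ_iff] using hi
    have e1 : ‖iteratedFDeriv ℝ i
        (fun y : Rd d => Complex.exp (Complex.I * (inner ℝ y ξ : ℝ))) x‖ ≤
        C' * ((h / 2) ^ i * (i.factorial : ℝ) ^ s) :=
      (norm_iteratedFDeriv_character_le ξ x i).trans (hb' i)
    have e2 := hb k (n - i) x
    have e3 : (i.factorial : ℝ) ^ s * ((n - i).factorial : ℝ) ^ s ≤ (n.factorial : ℝ) ^ s := by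
      rw [← Real.mul_rpow (by positivity) (by positivity)]
      gcongr
      exact_mod_cast Nat.le_of_dvd (Nat.factorial_pos _) (Nat.factorial_mul_factorial_dvd_factorial hi')
    have e4 : (h / 2) ^ i * (h / 2) ^ (k + (n - i)) = (h / 2) ^ (k + n) := by
      rw [← pow_add]; congr 1; omega
    calc _ = (n.choose i : ℝ) *
          (‖iteratedFDeriv ℝ i (fun y : Rd d => Complex.exp (Complex.I * (inner ℝ y ξ : ℝ))) x‖ *
          (‖x‖ ^ k * ‖iteratedFDeriv ℝ (n - i) f x‖)) := by ring
      _ ≤ (n.choose i : ℝ) * ((C' * ((h / 2) ^ i * (i.factorial : ℝ) ^ s)) *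
          (C * ((h / 2) ^ (k + (n - i)) * (k.factorial : ℝ) ^ t *
            ((n - i).factorial : ℝ) ^ s))) := by gcongr
      _ = (n.choose i : ℝ) * (C' * C * (((h / 2) ^ i * (h / 2) ^ (k + (n - i))) *
          (k.factorial : ℝ) ^ t *
          ((i.factorial : ℝ) ^ s * ((n - i).factorial : ℝ) ^ s))) := by ring
      _ ≤ _ := by rw [e4]; gcongr
  calc _ ≤ ‖x‖ ^ k * _ := mul_le_mul_of_nonneg_left h1 (by positivity)
    _ ≤ ∑ i ∈ Finset.range (n + 1), (n.choose i : ℝ) * (C' * C *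
        ((h / 2) ^ (k + n) * (k.factorial : ℝ) ^ t * (n.factorial : ℝ) ^ s)) := by
        rw [Finset.mul_sum]
        exact Finset.sum_le_sum hterm
    _ = C' * C * ((2 ^ n * (h / 2) ^ (k + n)) * (k.factorial : ℝ) ^ t *
        (n.factorial : ℝ) ^ s) := by
        rw [← Finset.sum_mul]
        have : ∑ i ∈ Finset.range (n + 1), (n.choose i : ℝ) = 2 ^ n := by
          exact_mod_cast Nat.sum_range_choose n
        rw [this]; ring
    _ ≤ _ := by
        gcongr
        calc (2 : ℝ) ^ n * (h / 2) ^ (k + n) ≤ 2 ^ (k + n) * (h / 2) ^ (k + n) := by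
              gcongr
              · norm_num
              · omega
          _ = h ^ (k + n) := by rw [← mul_pow]; congr 1; ring

theorem wordDeriv_add {f g : Rd d → ℂ} (hf : ContDiff ℝ ∞ f) (hg : ContDiff ℝ ∞ g)
    (L : List (Fin d)) : wordDeriv L (f + g) = wordDeriv L f + wordDeriv L g := by
  induction L with
  | nil => rfl
  | cons a L ih =>
    change partialDeriv a (wordDeriv L (f + g)) =
      partialDeriv a (wordDeriv L f) + partialDeriv a (wordDeriv L g)
    ext x
    rw [ih]
    unfold partialDeriv
    rw [fderiv_add ((contDiff_wordDeriv hf L).differentiable (by simp) x)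
      ((contDiff_wordDeriv hg L).differentiable (by simp) x)]
    rfl

theorem wordDeriv_smul {f : Rd d → ℂ} (hf : ContDiff ℝ ∞ f) (c : ℂ) (L : List (Fin d)) :
    wordDeriv L (c • f) = c • wordDeriv L f := by
  induction L with
  | nil => rfl
  | cons a L ih =>
    change partialDeriv a (wordDeriv L (c • f)) = c • partialDeriv a (wordDeriv L f)
    ext x
    rw [ih]
    unfold partialDeriv
    rw [fderiv_const_smul ((contDiff_wordDeriv hf L).differentiable (by simp) x)]
    rfl

theorem wordDeriv_zero (L : List (Fin d)) : wordDeriv L (0 : Rd d → ℂ) = 0 := by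
  have := wordDeriv_smul (f := (0 : Rd d → ℂ)) contDiff_const 0 L
  simpa using this

/-- The Beurling type Gelfand-Shilov space `Σ_t^s(ℝ^d) = ⋂_{h > 0} 𝓢_{t,h}^s(ℝ^d)`. -/
def gelfandShilovSpace (d : ℕ) (t s : ℝ) : Submodule ℂ (Rd d → ℂ) where
  carrier := {f | ContDiff ℝ ∞ f ∧ ∀ h : ℝ, 0 < h → gsNorm t s h f < ⊤}
  zero_mem' := by
    refine ⟨contDiff_const, fun h hh => (gsNorm_lt_top_iff hh _).2 ⟨0, le_rfl, fun α β x => ?_⟩⟩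
    rw [multiDeriv_eq_wordDeriv, wordDeriv_zero]
    simp
  add_mem' := by
    rintro f g ⟨hf, Hf⟩ ⟨hg, Hg⟩
    refine ⟨hf.add hg, fun h hh => ?_⟩
    obtain ⟨C, hC, hb⟩ := (gsNorm_lt_top_iff hh f).1 (Hf h hh)
    obtain ⟨C', hC', hb'⟩ := (gsNorm_lt_top_iff hh g).1 (Hg h hh)
    refine (gsNorm_lt_top_iff hh _).2 ⟨C + C', by positivity, fun α β x => ?_⟩
    have h1 := hb α β x
    have h2 := hb' α β x
    rw [multiDeriv_eq_wordDeriv] at h1 h2 ⊢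
    rw [wordDeriv_add hf hg, Pi.add_apply, mul_add, add_mul]
    exact (norm_add_le _ _).trans (add_le_add h1 h2)
  smul_mem' := by
    rintro c f ⟨hf, Hf⟩
    refine ⟨hf.const_smul c, fun h hh => ?_⟩
    obtain ⟨C, hC, hb⟩ := (gsNorm_lt_top_iff hh f).1 (Hf h hh)
    refine (gsNorm_lt_top_iff hh _).2 ⟨‖c‖ * C, by positivity, fun α β x => ?_⟩
    have h1 := hb α β x
    rw [multiDeriv_eq_wordDeriv] at h1 ⊢
    rw [wordDeriv_smul hf, Pi.smul_apply, smul_eq_mul, mul_left_comm, norm_mul, mul_assoc]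
    exact mul_le_mul_of_nonneg_left h1 (norm_nonneg c)

/-- The time-frequency shift `M_ξ T_x f`, that is `y ↦ e^{i⟨y, ξ⟩} f(y - x)`. -/
noncomputable def timeFreqShift (x ξ : Rd d) (f : Rd d → ℂ) : Rd d → ℂ :=
  fun y => Complex.exp (Complex.I * (inner ℝ y ξ : ℝ)) * f (y - x)

theorem timeFreqShift_mem {t s : ℝ} (ht : 0 < t) (hs : 0 < s) (x ξ : Rd d) {f : Rd d → ℂ}
    (hf : f ∈ gelfandShilovSpace d t s) : timeFreqShift x ξ f ∈ gelfandShilovSpace d t s := by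
  have hf1 : ContDiff ℝ ∞ f := hf.1
  have hsub : ContDiff ℝ ∞ (fun y => f (y - x)) := hf1.comp (contDiff_id.sub contDiff_const)
  have hmul : ContDiff ℝ ∞ (timeFreqShift x ξ f) := (contDiff_character ξ).mul hsub
  exact ⟨hmul, gsNorm_of_normBound ht.le hs.le hmul
    (((normBound_of_gsNorm ht.le hs.le hf1 hf.2).comp_sub ht x).modulation hs hsub ξ)⟩

/-- The space `(Σ_t^s)'(ℝ^d)` of Gelfand-Shilov ultradistributions. An element `u` acts as a
conjugate linear functional `φ ↦ (u, φ)` on `Σ_t^s(ℝ^d)`, and it is continuous: it is bounded by a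
multiple of one of the norms of `𝓢_{t,h}^s(ℝ^d)`, `h > 0`, which define the topology of
`Σ_t^s(ℝ^d)` and increase when `h` decreases. -/
structure Ultradistribution (d : ℕ) (t s : ℝ) where
  pairing : gelfandShilovSpace d t s →ₛₗ[starRingEnd ℂ] ℂ
  continuous' : ∃ h : ℝ, 0 < h ∧ ∃ C : ℝ≥0, ∀ φ : gelfandShilovSpace d t s,
    ‖pairing φ‖ₑ ≤ C * gsNorm t s h (φ : Rd d → ℂ)

/-- The ultradistribution `u` is the function `a`: `(u, φ) = ∫ a(x) conj(φ(x)) dx` for all test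
functions `φ`, with absolutely convergent integrals. -/
def Ultradistribution.IsFunction {t s : ℝ} (u : Ultradistribution d t s) (a : Rd d → ℂ) : Prop :=
  ∀ φ : gelfandShilovSpace d t s,
    MeasureTheory.Integrable (fun x => a x * starRingEnd ℂ ((φ : Rd d → ℂ) x)) ∧
      u.pairing φ = ∫ x, a x * starRingEnd ℂ ((φ : Rd d → ℂ) x)

/-- The short-time Fourier transform `V_ψ u(x, ξ) = (2π)^{-d/2} (u, M_ξ T_x ψ)`. -/
noncomputable def stft {t s : ℝ} (ht : 0 < t) (hs : 0 < s) (ψ : gelfandShilovSpace d t s)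
    (u : Ultradistribution d t s) (x ξ : Rd d) : ℂ :=
  (((2 * Real.pi) ^ (-(d : ℝ) / 2) : ℝ) : ℂ) *
    u.pairing ⟨timeFreqShift x ξ (ψ : Rd d → ℂ), timeFreqShift_mem ht hs x ξ ψ.2⟩

/-- The `t,s`-Gelfand-Shilov wave front set `WF^{t,s}(u) ⊆ T^*ℝ^d ∖ 0` of `u`, computed with the
window function `ψ ∈ Σ_t^s(ℝ^d) ∖ 0`. -/
def waveFrontSet {t s : ℝ} (ht : 0 < t) (hs : 0 < s) (ψ : gelfandShilovSpace d t s)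
    (u : Ultradistribution d t s) : Set (Rd d × Rd d) :=
  {p | p ≠ 0 ∧ ¬ ∃ U : Set (Rd d × Rd d), IsOpen U ∧ 0 ∉ U ∧ p ∈ U ∧
    ∀ r : ℝ, 0 < r → ∃ C : ℝ, ∀ l : ℝ, 0 < l → ∀ q ∈ U,
      Real.exp (r * l) * ‖stft ht hs ψ u (l ^ t • q.1) (l ^ s • q.2)‖ ≤ C}

end GelfandShilov

namespace GelfandShilov

open MeasureTheory Filter Topology

/-! ### Exponential bounds from factorial moment bounds -/

/-! For an exponential the short-time Fourier transform factorizes. Translating the integration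
variable by x gives V_ψ u(x, ξ) = (2π)^{-d/2} e^{⟨x, z - iξ⟩} L(ξ), where L(ξ) = ∫ e^{⟨y, z - iξ⟩}
conj(ψ(y)) dy depends on ξ only (`norm_stft_cexp_linForm`). With R = ∑ |Re z_j|, the modulus of the
first exponential lies between e^{-R|x|} and e^{R|x|}. At λ^t x with t ≤ 1 it therefore grows or
decays at most like e^{O(λ)} when x stays bounded, and everything depends on L.

Since t ≤ 1, the window decays with all its derivatives faster than every e^{-R|x|}, so the
integrals converge and integration by parts is allowed. This gives |L(ξ)| ≤ C_r e^{-r|ξ|^{1/s}} for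
every r > 0 (`exp_mul_norm_laplace_le`). At λ^s ξ with |ξ| > ε the bound is superexponential in the
sense that it beats every e^{O(λ)}; hence no point with ξ_0 ≠ 0 lies in the wave front set.

Conversely, L is the Fourier transform of a nonzero function, so L(η) ≠ 0 for some η
(`exists_laplace_ne_zero`). The points (x_0, λ^{-s} η) tend to (x_0, 0), and after scaling their
frequency is η for every λ. The transform is then at least a constant times e^{-R|x_0|λ} for λ ≥ 1,
which rules out decay at every exponential rate. -/

/-- The exponential series is compared termwise with a geometric series of ratio 1/2, whose sum is
the factor 2. -/
theorem exp_mul_le_of_forall_pow_mul_le {a b M : ℝ}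
    (h : ∀ k : ℕ, a ^ k * b ≤ M * ((1 / 2) ^ k * (k.factorial : ℝ))) :
    Real.exp a * b ≤ 2 * M := by
  have h1 : HasSum (fun k : ℕ => a ^ k / (k.factorial : ℝ) * b) (Real.exp a * b) := by
    rw [Real.exp_eq_exp_ℝ]
    exact (NormedSpace.expSeries_div_hasSum_exp a).mul_right b
  have h2 : HasSum (fun k : ℕ => M * (1 / 2 : ℝ) ^ k) (M * 2) := hasSum_geometric_two.mul_left M
  rw [mul_comm 2]
  refine hasSum_le (fun k => ?_) h1 h2
  have hk : (0 : ℝ) < k.factorial := by positivity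
  rw [div_mul_eq_mul_div, div_le_iff₀ hk, mul_assoc]
  exact h k

/-- Turns moment bounds with k!^t into bounds that the exponential series can absorb; this is how t
≤ 1 yields exponential decay. -/
theorem factorial_rpow_le {t : ℝ} (ht1 : t ≤ 1) (k : ℕ) :
    (k.factorial : ℝ) ^ t ≤ (k.factorial : ℝ) := by
  have h1 : (1 : ℝ) ≤ k.factorial := by exact_mod_cast k.factorial_pos
  simpa using Real.rpow_le_rpow_of_exponent_le h1 ht1

variable {d : ℕ}

theorem multiFactorial_zero : multiFactorial (0 : Fin d → ℕ) = 1 := by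
  simp [multiFactorial]

theorem length_zero : length (0 : Fin d → ℕ) = 0 := by
  simp [length]

theorem multiDeriv_zero (f : Rd d → ℂ) : multiDeriv 0 f = f := by
  have : word (0 : Fin d → ℕ) = [] := by
    rw [← List.length_eq_zero_iff, length_word, length_zero]
  rw [multiDeriv_eq_wordDeriv, this]
  rfl

theorem gsNorm_bound {t s h : ℝ} {f : Rd d → ℂ} (hlt : gsNorm t s h f < ⊤) (hh : 0 < h)
    (α : Fin d → ℕ) (x : Rd d) :
    |monomial α x| * ‖f x‖ ≤
      (gsNorm t s h f).toReal * (h ^ length α * (multiFactorial α : ℝ) ^ t) := by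
  have hpos : 0 < h ^ length α * (multiFactorial α : ℝ) ^ t := by
    have h1 : (0 : ℝ) < multiFactorial α := by
      unfold multiFactorial; exact_mod_cast Finset.prod_pos fun j _ => Nat.factorial_pos _
    positivity
  rw [← div_le_iff₀ hpos, ← ENNReal.ofReal_le_iff_le_toReal hlt.ne]
  refine le_trans (le_of_eq ?_)
    (le_iSup_of_le α (le_iSup_of_le (0 : Fin d → ℕ) (le_iSup_of_le x le_rfl)))
  rw [multiDeriv_zero, length_zero, multiFactorial_zero, norm_mul, Complex.norm_real,
    Real.norm_eq_abs]
  simp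

/-- The decay is controlled by a single norm with h depending only on R and d, as continuity of the
functional requires. Expanding |x|^k costs d^k monomials, and h makes R d h ≤ 1/2; the added ones
keep the denominator positive when R or d vanishes. -/
theorem exp_mul_norm_le_gsNorm {t s R : ℝ} (ht : 0 ≤ t) (ht1 : t ≤ 1) (hR : 0 ≤ R)
    {f : Rd d → ℂ} (hlt : gsNorm t s (1 / (2 * (R + 1) * (d + 1))) f < ⊤) (x : Rd d) :
    Real.exp (R * ‖x‖) * ‖f x‖ ≤
      2 * (gsNorm t s (1 / (2 * (R + 1) * (d + 1))) f).toReal := by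
  set h : ℝ := 1 / (2 * (R + 1) * (d + 1)) with hdef
  have hh : 0 < h := by positivity
  refine exp_mul_le_of_forall_pow_mul_le fun k => ?_
  have hN : 0 ≤ (gsNorm t s h f).toReal := ENNReal.toReal_nonneg
  have hterm : ∀ p : Fin k → Fin d,
      |monomial (fun j => (List.ofFn p).count j) x| * ‖f x‖ ≤
        (gsNorm t s h f).toReal * (h ^ k * (k.factorial : ℝ)) := by
    intro p
    have h1 := gsNorm_bound hlt hh (fun j => (List.ofFn p).count j) x
    have h2 := multiFactorial_le (fun j => (List.ofFn p).count j)
    rw [length_count, List.length_ofFn] at h1 h2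
    refine h1.trans ?_
    gcongr
    refine le_trans ?_ (factorial_rpow_le ht1 k)
    gcongr
  have hsum : ‖x‖ ^ k * ‖f x‖ ≤ d ^ k * ((gsNorm t s h f).toReal * (h ^ k * k.factorial)) := by
    calc ‖x‖ ^ k * ‖f x‖
        ≤ (∑ p : Fin k → Fin d, |monomial (fun j => (List.ofFn p).count j) x|) * ‖f x‖ := by
          gcongr
          exact norm_pow_le x k
      _ ≤ ∑ _p : Fin k → Fin d, (gsNorm t s h f).toReal * (h ^ k * (k.factorial : ℝ)) := by
          rw [Finset.sum_mul]
          exact Finset.sum_le_sum fun p _ => hterm p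
      _ = _ := by simp
  have hRh : R * d * h ≤ 1 / 2 := by
    rw [hdef, mul_one_div, div_le_div_iff₀ (by positivity) (by norm_num)]
    nlinarith [mul_nonneg hR (Nat.cast_nonneg (α := ℝ) d), Nat.cast_nonneg (α := ℝ) d]
  calc (R * ‖x‖) ^ k * ‖f x‖ = R ^ k * (‖x‖ ^ k * ‖f x‖) := by ring
    _ ≤ R ^ k * (d ^ k * ((gsNorm t s h f).toReal * (h ^ k * k.factorial))) := by gcongr
    _ = (gsNorm t s h f).toReal * ((R * d * h) ^ k * k.factorial) := by ring
    _ ≤ _ := by gcongr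

/-- The same summation over k at fixed n: the factor in n passes through it, so C does not depend on
n. -/
theorem NormBound.exp_mul_le {t s R : ℝ} (ht1 : t ≤ 1) (hR : 0 ≤ R) {f : Rd d → ℂ}
    (H : NormBound t s f) {h : ℝ} (hh : 0 < h) :
    ∃ C : ℝ, 0 ≤ C ∧ ∀ (n : ℕ) (x : Rd d),
      Real.exp (R * ‖x‖) * ‖iteratedFDeriv ℝ n f x‖ ≤ C * (h ^ n * (n.factorial : ℝ) ^ s) := by
  set h' : ℝ := min h (1 / (2 * (R + 1))) with hdef
  have hh' : 0 < h' := by positivity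
  obtain ⟨C, hC, hb⟩ := H h' hh'
  refine ⟨2 * C, by positivity, fun n x => ?_⟩
  rw [mul_assoc 2 C]
  refine exp_mul_le_of_forall_pow_mul_le fun k => ?_
  have hRh : R * h' ≤ 1 / 2 := by
    calc R * h' ≤ R * (1 / (2 * (R + 1))) := by gcongr; exact min_le_right _ _
      _ ≤ 1 / 2 := by
        rw [mul_one_div, div_le_div_iff₀ (by positivity) (by norm_num)]
        nlinarith
  have hh1 : h' ≤ h := min_le_left _ _
  calc (R * ‖x‖) ^ k * ‖iteratedFDeriv ℝ n f x‖
      = R ^ k * (‖x‖ ^ k * ‖iteratedFDeriv ℝ n f x‖) := by ring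
    _ ≤ R ^ k * (C * (h' ^ (k + n) * (k.factorial : ℝ) ^ t * (n.factorial : ℝ) ^ s)) :=
        mul_le_mul_of_nonneg_left (hb k n x) (by positivity)
    _ ≤ R ^ k * (C * (h' ^ (k + n) * (k.factorial : ℝ) * (n.factorial : ℝ) ^ s)) := by
        gcongr
        exact factorial_rpow_le ht1 k
    _ = C * (h' ^ n * (n.factorial : ℝ) ^ s) * ((R * h') ^ k * (k.factorial : ℝ)) := by
        rw [pow_add, mul_pow]; ring
    _ ≤ _ := by gcongr

/-! ### Integrals of products of exponential growth and decay. -/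

theorem integrable_exp_neg_norm : Integrable (fun x : Rd d => Real.exp (-‖x‖)) := by
  have h1 : Integrable (fun x : Rd d => (1 + ‖x‖) ^ (-((d + 1 : ℕ) : ℝ))) :=
    integrable_one_add_norm (by simp)
  refine (h1.const_mul (Real.exp 1 * (d + 1).factorial)).mono' (by fun_prop) ?_
  refine Eventually.of_forall fun x => ?_
  have h2 := Real.pow_div_factorial_le_exp (1 + ‖x‖) (by positivity) (d + 1)
  rw [div_le_iff₀ (by positivity)] at h2
  have hx : 0 < 1 + ‖x‖ := by positivity
  rw [Real.norm_eq_abs, abs_of_pos (Real.exp_pos _), Real.rpow_neg hx.le, Real.rpow_natCast,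
    ← div_eq_mul_inv, le_div_iff₀ (by positivity), Real.exp_neg, inv_mul_le_iff₀ (Real.exp_pos _)]
  calc _ ≤ _ := h2
    _ = _ := by rw [Real.exp_add]; ring

/-- The rate R + 1 exceeds the growth rate R by one, which leaves the integrable majorant e^{-|x|}.
-/
theorem norm_mul_le_exp_neg_norm {R A : ℝ} {e f : Rd d → ℂ}
    (he : ∀ x, ‖e x‖ ≤ Real.exp (R * ‖x‖)) (hfb : ∀ x, Real.exp ((R + 1) * ‖x‖) * ‖f x‖ ≤ A)
    (x : Rd d) : ‖e x * f x‖ ≤ A * Real.exp (-‖x‖) := by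
  rw [norm_mul]
  have e1 : Real.exp (R * ‖x‖) = Real.exp ((R + 1) * ‖x‖) * Real.exp (-‖x‖) := by
    rw [← Real.exp_add]; ring_nf
  calc ‖e x‖ * ‖f x‖ ≤ Real.exp (R * ‖x‖) * ‖f x‖ := by gcongr; exact he x
    _ = (Real.exp ((R + 1) * ‖x‖) * ‖f x‖) * Real.exp (-‖x‖) := by rw [e1]; ring
    _ ≤ _ := by gcongr; exact hfb x

theorem integrable_mul_of_exp_bound {R A : ℝ} {e f : Rd d → ℂ} (hec : Continuous e)
    (hfc : Continuous f) (he : ∀ x, ‖e x‖ ≤ Real.exp (R * ‖x‖))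
    (hfb : ∀ x, Real.exp ((R + 1) * ‖x‖) * ‖f x‖ ≤ A) : Integrable (fun x => e x * f x) :=
  (integrable_exp_neg_norm.const_mul A).mono' (hec.mul hfc).aestronglyMeasurable
    (Eventually.of_forall (norm_mul_le_exp_neg_norm he hfb))

theorem norm_integral_mul_le_of_exp_bound {R A : ℝ} {e f : Rd d → ℂ}
    (he : ∀ x, ‖e x‖ ≤ Real.exp (R * ‖x‖)) (hfb : ∀ x, Real.exp ((R + 1) * ‖x‖) * ‖f x‖ ≤ A) :
    ‖∫ x, e x * f x‖ ≤ A * ∫ x : Rd d, Real.exp (-‖x‖) := by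
  rw [← integral_const_mul]
  exact norm_integral_le_of_norm_le (integrable_exp_neg_norm.const_mul A)
    (Eventually.of_forall (norm_mul_le_exp_neg_norm he hfb))

/-! ### Exponential functions -/

/-- The linear form `x ↦ ⟨x, ζ⟩ = ∑ x_j ζ_j`. -/
noncomputable def linForm (ζ : Fin d → ℂ) : Rd d →L[ℝ] ℂ :=
  ∑ j, ζ j • (Complex.ofRealCLM.comp (EuclideanSpace.proj j))

theorem linForm_apply (ζ : Fin d → ℂ) (x : Rd d) : linForm ζ x = ∑ j, (x j : ℂ) * ζ j := by
  simp [linForm, mul_comm]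

theorem abs_re_linForm_le (ζ : Fin d → ℂ) (x : Rd d) :
    |(linForm ζ x).re| ≤ (∑ j, |(ζ j).re|) * ‖x‖ := by
  rw [linForm_apply, Complex.re_sum, Finset.sum_mul]
  refine (Finset.abs_sum_le_sum_abs _ _).trans (Finset.sum_le_sum fun j _ => ?_)
  rw [Complex.re_ofReal_mul, abs_mul, mul_comm]
  gcongr
  exact PiLp.norm_apply_le x j

theorem norm_linForm_le (ζ : Fin d → ℂ) (x : Rd d) :
    ‖linForm ζ x‖ ≤ (∑ j, ‖ζ j‖) * ‖x‖ := by
  rw [linForm_apply, Finset.sum_mul]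
  refine (norm_sum_le _ _).trans (Finset.sum_le_sum fun j _ => ?_)
  rw [norm_mul, mul_comm, Complex.norm_real]
  gcongr
  exact PiLp.norm_apply_le x j

theorem norm_cexp_linForm_le (ζ : Fin d → ℂ) (x : Rd d) :
    ‖Complex.exp (linForm ζ x)‖ ≤ Real.exp ((∑ j, |(ζ j).re|) * ‖x‖) := by
  rw [Complex.norm_exp]
  exact Real.exp_le_exp.2 ((le_abs_self _).trans (abs_re_linForm_le ζ x))

theorem exp_neg_le_norm_cexp_linForm (ζ : Fin d → ℂ) (x : Rd d) :
    Real.exp (-((∑ j, |(ζ j).re|) * ‖x‖)) ≤ ‖Complex.exp (linForm ζ x)‖ := by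
  rw [Complex.norm_exp]
  exact Real.exp_le_exp.2 (neg_le_of_abs_le (abs_re_linForm_le ζ x))

theorem continuous_cexp_linForm (ζ : Fin d → ℂ) :
    Continuous fun x : Rd d => Complex.exp (linForm ζ x) := by fun_prop

/-- The frequency shift `z - iξ` of `z`. -/
noncomputable def freqShift (z : Fin d → ℂ) (ξ : Rd d) : Fin d → ℂ :=
  fun j => z j - Complex.I * (ξ j : ℂ)

theorem linForm_freqShift (z : Fin d → ℂ) (ξ x : Rd d) :
    linForm (freqShift z ξ) x = linForm z x - Complex.I * (inner ℝ x ξ : ℝ) := by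
  simp only [linForm_apply, freqShift, mul_sub, Finset.sum_sub_distrib, PiLp.inner_apply,
    RCLike.inner_apply, conj_trivial, Complex.ofReal_sum, Finset.mul_sum, Complex.ofReal_mul]
  congr 1
  exact Finset.sum_congr rfl fun j _ => by ring

/-- The shift by -iξ is imaginary, so growth bounds for the shifted exponential are uniform in ξ. -/
theorem sum_abs_re_freqShift (z : Fin d → ℂ) (ξ : Rd d) :
    ∑ j, |(freqShift z ξ j).re| = ∑ j, |(z j).re| := by
  simp [freqShift]

/-- The Fourier-Laplace transform `∫ e^{⟨y, z - iξ⟩} f(y) dy`. -/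
noncomputable def laplace (z : Fin d → ℂ) (f : Rd d → ℂ) (ξ : Rd d) : ℂ :=
  ∫ y, Complex.exp (linForm (freqShift z ξ) y) * f y

/-! ### Decay and nonvanishing of the Fourier-Laplace transform. -/

/-- Integration by parts n times in the direction v, in which the exponential is an eigenfunction of
the derivative with eigenvalue ⟨v, ζ⟩. -/
theorem integral_cexp_mul_iteratedFDeriv {t s : ℝ} (ht1 : t ≤ 1) {f : Rd d → ℂ}
    (hf : ContDiff ℝ ∞ f) (H : NormBound t s f) (ζ : Fin d → ℂ) (v : Rd d) (n : ℕ) :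
    ∫ y, Complex.exp (linForm ζ y) * iteratedFDeriv ℝ n f y (fun _ => v) =
      (-linForm ζ v) ^ n * ∫ y, Complex.exp (linForm ζ y) * f y := by
  have hd : ∀ m : ℕ, Differentiable ℝ (iteratedFDeriv ℝ m f) := fun m =>
    hf.differentiable_iteratedFDeriv (by exact_mod_cast ENat.natCast_lt_top _)
  have hdv : ∀ m : ℕ, Differentiable ℝ (fun y => iteratedFDeriv ℝ m f y (fun _ => v)) := fun m y =>
    (hd m y).continuousMultilinear_apply_const _
  have hint : ∀ m : ℕ, Integrable (fun y => Complex.exp (linForm ζ y) *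
      iteratedFDeriv ℝ m f y (fun _ => v)) := by
    intro m
    obtain ⟨C, hC, hb⟩ := H.exp_mul_le ht1 (R := (∑ j, |(ζ j).re|) + 1) (by positivity) one_pos
    refine integrable_mul_of_exp_bound (A := C * (1 ^ m * (m.factorial : ℝ) ^ s) * ‖v‖ ^ m)
      (continuous_cexp_linForm ζ) (hdv m).continuous (norm_cexp_linForm_le ζ) fun x => ?_
    calc _ ≤ Real.exp ((∑ j, |(ζ j).re| + 1) * ‖x‖) * (‖iteratedFDeriv ℝ m f x‖ * ‖v‖ ^ m) := by
          gcongr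
          simpa using (iteratedFDeriv ℝ m f x).le_opNorm (fun _ => v)
      _ = (Real.exp ((∑ j, |(ζ j).re| + 1) * ‖x‖) * ‖iteratedFDeriv ℝ m f x‖) * ‖v‖ ^ m := by ring
      _ ≤ _ := mul_le_mul_of_nonneg_right (hb m x) (by positivity)
  induction n with
  | zero => simp
  | succ n ih =>
    have hE : ∀ y, HasFDerivAt (fun y : Rd d => Complex.exp (linForm ζ y))
        (Complex.exp (linForm ζ y) • linForm ζ) y := fun y => (linForm ζ).hasFDerivAt.cexp
    have hEd : ∀ y, fderiv ℝ (fun y : Rd d => Complex.exp (linForm ζ y)) y v =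
        linForm ζ v * Complex.exp (linForm ζ y) := by
      intro y; rw [(hE y).fderiv]; simp [mul_comm]
    have hfd : ∀ y, fderiv ℝ (fun y => iteratedFDeriv ℝ n f y (fun _ => v)) y v =
        iteratedFDeriv ℝ (n + 1) f y (fun _ => v) := by
      intro y
      rw [fderiv_continuousMultilinear_apply_const_apply (hd n y), iteratedFDeriv_succ_apply_left]
      rfl
    have key := integral_mul_fderiv_eq_neg_fderiv_mul_of_integrable (μ := volume) (𝕜 := ℂ)
      (f := fun y : Rd d => Complex.exp (linForm ζ y))
      (g := fun y => iteratedFDeriv ℝ n f y (fun _ => v)) (v := v)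
      (by simp only [hEd, mul_assoc]; exact (hint n).const_mul _)
      (by simp only [hfd]; exact hint (n + 1)) (hint n)
      (fun y _ => (hE y).differentiableAt) (fun y _ => hdv n y)
    simp only [hfd, hEd, mul_assoc] at key
    rw [key, integral_const_mul, ih, pow_succ]
    ring

/-- Integration by parts in the direction ξ itself produces the factor ⟨ξ, z⟩ - i|ξ|², of modulus at
least (|ξ| - S)|ξ| with S = ∑ |z_j|. This bounds powers of |ξ| - S; the powers of S that are missing
are absorbed by n!^s. -/
theorem pow_mul_norm_laplace_le {t s : ℝ} (ht1 : t ≤ 1) (hs : 0 < s) {f : Rd d → ℂ}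
    (hf : ContDiff ℝ ∞ f) (H : NormBound t s f) (z : Fin d → ℂ) {h : ℝ} (hh : 0 < h) :
    ∃ C : ℝ, 0 ≤ C ∧ ∀ (n : ℕ) (ξ : Rd d),
      ‖ξ‖ ^ n * ‖laplace z f ξ‖ ≤ C * (h ^ n * (n.factorial : ℝ) ^ s) := by
  have hh' : 0 < h / 2 := by positivity
  set R : ℝ := ∑ j, |(z j).re| with hR
  set S : ℝ := ∑ j, ‖z j‖ with hS
  have hR0 : 0 ≤ R := by positivity
  have hS0 : 0 ≤ S := by positivity
  obtain ⟨C, hC, hb⟩ := H.exp_mul_le ht1 (R := R + 1) (by positivity) hh'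
  obtain ⟨C', hC', hb'⟩ := pow_le_factorial S hS0 hh' hs
  set I : ℝ := ∫ x : Rd d, Real.exp (-‖x‖)
  have hI : 0 ≤ I := integral_nonneg fun x => (Real.exp_pos _).le
  have hexp : ∀ (ξ x : Rd d), ‖Complex.exp (linForm (freqShift z ξ) x)‖ ≤ Real.exp (R * ‖x‖) := by
    intro ξ x
    simpa only [sum_abs_re_freqShift] using norm_cexp_linForm_le (freqShift z ξ) x
  have hG : ∀ ξ : Rd d, ‖laplace z f ξ‖ ≤ C * I := by
    intro ξ
    refine norm_integral_mul_le_of_exp_bound (hexp ξ) fun x => ?_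
    simpa using hb 0 x
  have hD : ∀ (n : ℕ) (ξ : Rd d), S ≤ ‖ξ‖ →
      (‖ξ‖ - S) ^ n * ‖laplace z f ξ‖ ≤ C * I * ((h / 2) ^ n * (n.factorial : ℝ) ^ s) := by
    intro n ξ hξ
    rcases n.eq_zero_or_pos with rfl | hn
    · simpa using hG ξ
    -- For ξ = 0 no division by |ξ|^n is possible, but then S = 0 and the left side vanishes because
    -- n > 0.
    rcases (norm_nonneg ξ).eq_or_lt with h0 | h0
    · have : ‖ξ‖ - S = 0 := by linarith
      rw [this, zero_pow hn.ne', zero_mul]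
      positivity
    have h1 := integral_cexp_mul_iteratedFDeriv ht1 hf H (freqShift z ξ) ξ n
    have h2 : ‖∫ y, Complex.exp (linForm (freqShift z ξ) y) *
        iteratedFDeriv ℝ n f y (fun _ => ξ)‖ ≤
          (C * ((h / 2) ^ n * (n.factorial : ℝ) ^ s) * ‖ξ‖ ^ n) * I := by
      refine norm_integral_mul_le_of_exp_bound (hexp ξ) fun x => ?_
      calc _ ≤ Real.exp ((R + 1) * ‖x‖) * (‖iteratedFDeriv ℝ n f x‖ * ‖ξ‖ ^ n) := by
            gcongr
            simpa using (iteratedFDeriv ℝ n f x).le_opNorm (fun _ => ξ)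
        _ = (Real.exp ((R + 1) * ‖x‖) * ‖iteratedFDeriv ℝ n f x‖) * ‖ξ‖ ^ n := by ring
        _ ≤ _ := mul_le_mul_of_nonneg_right (hb n x) (by positivity)
    rw [h1, norm_mul, norm_pow, norm_neg] at h2
    have h3 : (‖ξ‖ - S) * ‖ξ‖ ≤ ‖linForm (freqShift z ξ) ξ‖ := by
      rw [linForm_freqShift, real_inner_self_eq_norm_sq]
      have e1 := norm_linForm_le z ξ
      have e2 : ‖Complex.I * ((‖ξ‖ ^ 2 : ℝ) : ℂ)‖ = ‖ξ‖ ^ 2 := by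
        rw [norm_mul, Complex.norm_I, Complex.norm_real]; simp
      have e3 := norm_sub_norm_le (Complex.I * ((‖ξ‖ ^ 2 : ℝ) : ℂ)) (linForm z ξ)
      rw [norm_sub_rev, e2] at e3
      nlinarith
    have h4 : ((‖ξ‖ - S) * ‖ξ‖) ^ n * ‖laplace z f ξ‖ ≤
        (C * ((h / 2) ^ n * (n.factorial : ℝ) ^ s) * ‖ξ‖ ^ n) * I := by
      refine le_trans ?_ h2
      refine mul_le_mul_of_nonneg_right ?_ (norm_nonneg _)
      exact pow_le_pow_left₀ (mul_nonneg (by linarith) h0.le) h3 n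
    have h5 : 0 < ‖ξ‖ ^ n := by positivity
    refine le_of_mul_le_mul_right ?_ h5
    calc _ = ((‖ξ‖ - S) * ‖ξ‖) ^ n * ‖laplace z f ξ‖ := by rw [mul_pow]; ring
      _ ≤ _ := h4
      _ = _ := by ring
  refine ⟨(1 + C') * (C * I), by positivity, fun n ξ => ?_⟩
  have hS' : S ^ n * ‖laplace z f ξ‖ ≤ C' * ((h / 2) ^ n * (n.factorial : ℝ) ^ s) * (C * I) := by
    gcongr
    · exact hb' n
    · exact hG ξ
  have h2n : (2 : ℝ) ^ n * (h / 2) ^ n = h ^ n := by rw [← mul_pow]; congr 1; ring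
  -- Splitting |ξ| as (|ξ| - S) + S costs 2^n, which is why the bounds above are taken with h / 2.
  rcases le_total S ‖ξ‖ with hle | hle
  · have e1 : ‖ξ‖ ^ n ≤ 2 ^ n * ((‖ξ‖ - S) ^ n + S ^ n) := by
      calc ‖ξ‖ ^ n = ((‖ξ‖ - S) + S) ^ n := by ring_nf
        _ ≤ 2 ^ (n - 1) * ((‖ξ‖ - S) ^ n + S ^ n) := add_pow_le (by linarith) hS0 n
        _ ≤ _ := by
          have : 0 ≤ ‖ξ‖ - S := by linarith
          gcongr <;> norm_num
    calc _ ≤ (2 ^ n * ((‖ξ‖ - S) ^ n + S ^ n)) * ‖laplace z f ξ‖ := by gcongr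
      _ = 2 ^ n * ((‖ξ‖ - S) ^ n * ‖laplace z f ξ‖ + S ^ n * ‖laplace z f ξ‖) := by ring
      _ ≤ 2 ^ n * (C * I * ((h / 2) ^ n * (n.factorial : ℝ) ^ s) +
          C' * ((h / 2) ^ n * (n.factorial : ℝ) ^ s) * (C * I)) := by
          exact mul_le_mul_of_nonneg_left (add_le_add (hD n ξ hle) hS') (by positivity)
      _ = (1 + C') * (C * I) * ((2 ^ n * (h / 2) ^ n) * (n.factorial : ℝ) ^ s) := by ring
      _ = _ := by rw [h2n]
  · calc _ ≤ S ^ n * ‖laplace z f ξ‖ := by gcongr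
      _ ≤ C' * ((h / 2) ^ n * (n.factorial : ℝ) ^ s) * (C * I) := hS'
      _ ≤ C' * (h ^ n * (n.factorial : ℝ) ^ s) * (C * I) := by gcongr; linarith
      _ = C' * (C * I) * (h ^ n * (n.factorial : ℝ) ^ s) := by ring
      _ ≤ _ := by gcongr; linarith

/-- Raising the moment bounds to the power 1/s turns n!^s into n!, so the exponential series can be
summed; the power s then restores the transform. -/
theorem exp_mul_norm_laplace_le {t s : ℝ} (ht1 : t ≤ 1) (hs : 0 < s) {f : Rd d → ℂ}
    (hf : ContDiff ℝ ∞ f) (H : NormBound t s f) (z : Fin d → ℂ) {r : ℝ} (hr : 0 < r) :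
    ∃ C : ℝ, 0 ≤ C ∧ ∀ ξ : Rd d,
      Real.exp (r * ‖ξ‖ ^ (1 / s)) * ‖laplace z f ξ‖ ≤ C := by
  -- Here h^{1/s} = s / (2r), so that (r / s) h^{1/s} is the ratio 1/2 of the geometric series.
  obtain ⟨C, hC, hb⟩ := pow_mul_norm_laplace_le ht1 hs hf H z (h := (s / (2 * r)) ^ s)
    (by positivity)
  refine ⟨(2 * C ^ (1 / s)) ^ s, by positivity, fun ξ => ?_⟩
  have hpow : ∀ (a : ℝ) (_ : 0 ≤ a) (n : ℕ) (p : ℝ), (a ^ n) ^ p = (a ^ p) ^ n := by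
    intro a ha n p
    rw [← Real.rpow_natCast, ← Real.rpow_natCast, ← Real.rpow_mul ha, ← Real.rpow_mul ha, mul_comm]
  have hcancel : ∀ a : ℝ, 0 ≤ a → (a ^ s) ^ (1 / s) = a := by
    intro a ha
    rw [← Real.rpow_mul ha, mul_one_div_cancel hs.ne', Real.rpow_one]
  have hcancel' : ∀ a : ℝ, 0 ≤ a → (a ^ (1 / s)) ^ s = a := by
    intro a ha
    rw [← Real.rpow_mul ha, one_div_mul_cancel hs.ne', Real.rpow_one]
  have key : Real.exp (r / s * ‖ξ‖ ^ (1 / s)) * ‖laplace z f ξ‖ ^ (1 / s) ≤ 2 * C ^ (1 / s) := by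
    refine exp_mul_le_of_forall_pow_mul_le fun n => ?_
    have h1 : (‖ξ‖ ^ n * ‖laplace z f ξ‖) ^ (1 / s) ≤
        (C * (((s / (2 * r)) ^ s) ^ n * (n.factorial : ℝ) ^ s)) ^ (1 / s) :=
      Real.rpow_le_rpow (by positivity) (hb n ξ) (by positivity)
    rw [Real.mul_rpow (by positivity) (by positivity), Real.mul_rpow (by positivity) (by positivity),
      Real.mul_rpow (by positivity) (by positivity), hpow _ (by positivity),
      hpow _ (by positivity), hcancel _ (by positivity), hcancel _ (by positivity)] at h1
    calc _ = (r / s) ^ n * ((‖ξ‖ ^ (1 / s)) ^ n * ‖laplace z f ξ‖ ^ (1 / s)) := by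
          rw [mul_pow]; ring
      _ ≤ (r / s) ^ n * (C ^ (1 / s) * ((s / (2 * r)) ^ n * (n.factorial : ℝ))) := by gcongr
      _ = C ^ (1 / s) * ((r / s * (s / (2 * r))) ^ n * (n.factorial : ℝ)) := by
          rw [mul_pow]; ring
      _ = _ := by
          congr 3
          field_simp
  have h2 : (Real.exp (r / s * ‖ξ‖ ^ (1 / s)) * ‖laplace z f ξ‖ ^ (1 / s)) ^ s ≤
      (2 * C ^ (1 / s)) ^ s := by gcongr
  rw [Real.mul_rpow (by positivity) (by positivity), hcancel' _ (norm_nonneg _),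
    ← Real.exp_mul] at h2
  convert h2 using 3
  field_simp

/-- Up to a dilation by 2π the transform is the Fourier transform of the continuous integrable
function e^{⟨·, z⟩} f. If it vanished, Fourier inversion would make this function zero, and f with
it. -/
theorem exists_laplace_ne_zero {t s : ℝ} (ht1 : t ≤ 1) {f : Rd d → ℂ}
    (hf : Continuous f) (H : NormBound t s f) (z : Fin d → ℂ) (hf0 : f ≠ 0) :
    ∃ ξ : Rd d, laplace z f ξ ≠ 0 := by
  by_contra! hz
  set g : Rd d → ℂ := fun y => Complex.exp (linForm z y) * f y with hg
  have hgc : Continuous g := (continuous_cexp_linForm z).mul hf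
  have hgi : Integrable g := by
    obtain ⟨C, hC, hb⟩ := H.exp_mul_le ht1 (R := (∑ j, |(z j).re|) + 1) (by positivity) one_pos
    refine integrable_mul_of_exp_bound (A := C) (continuous_cexp_linForm z) hf
      (norm_cexp_linForm_le z) fun x => ?_
    simpa using hb 0 x
  have hF : FourierTransform.fourier g = 0 := by
    ext w
    rw [Real.fourier_eq', Pi.zero_apply, ← hz ((2 * Real.pi) • w)]
    refine integral_congr_ae (Eventually.of_forall fun y => ?_)
    simp only [hg, smul_eq_mul, linForm_freqShift, inner_smul_right]
    rw [← mul_assoc, ← Complex.exp_add]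
    congr 2
    push_cast
    ring
  have hinv := hgc.fourierInv_fourier_eq hgi (by rw [hF]; exact integrable_zero _ _ _)
  rw [hF] at hinv
  apply hf0
  ext y
  have h1 : g y = 0 := by
    rw [← hinv, Real.fourierInv_eq']
    simp
  simpa [hg, Complex.exp_ne_zero] using h1

/-! ### Exponential functions as ultradistributions -/

theorem integrable_cexp_mul_conj {t s : ℝ} (ht : 0 < t) (ht1 : t ≤ 1) (z : Fin d → ℂ)
    (φ : gelfandShilovSpace d t s) :
    Integrable (fun x => Complex.exp (linForm z x) * starRingEnd ℂ ((φ : Rd d → ℂ) x)) := by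
  have hR : 0 ≤ ∑ j, |(z j).re| + 1 := by positivity
  refine integrable_mul_of_exp_bound
    (A := 2 * (gsNorm t s (1 / (2 * (∑ j, |(z j).re| + 1 + 1) * (d + 1))) (φ : Rd d → ℂ)).toReal)
    (continuous_cexp_linForm z) (Complex.continuous_conj.comp φ.2.1.continuous) (norm_cexp_linForm_le z) fun x => ?_
  rw [RCLike.norm_conj]
  exact exp_mul_norm_le_gsNorm ht.le ht1 hR (φ.2.2 _ (by positivity)) x

theorem exists_isFunction_cexp_linForm {t : ℝ} (s : ℝ) (ht : 0 < t) (ht1 : t ≤ 1)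
    (z : Fin d → ℂ) :
    ∃ u : Ultradistribution d t s, u.IsFunction fun x => Complex.exp (linForm z x) := by
  have hint := integrable_cexp_mul_conj (s := s) ht ht1 z
  -- The summand 1 is the spare decay rate that makes the integrals converge; I is the integral of
  -- the remaining e^{-|x|}.
  set R : ℝ := ∑ j, |(z j).re| + 1 with hRdef
  have hR : 0 ≤ R := by positivity
  set I : ℝ := ∫ x : Rd d, Real.exp (-‖x‖)
  have hI : 0 ≤ I := integral_nonneg fun x => (Real.exp_pos _).le
  refine ⟨⟨{ toFun := fun φ => ∫ x, Complex.exp (linForm z x) *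
                starRingEnd ℂ ((φ : Rd d → ℂ) x)
             map_add' := fun φ χ => ?_
             map_smul' := fun c φ => ?_ },
    1 / (2 * (R + 1) * (d + 1)), by positivity, Real.toNNReal (2 * I), fun φ => ?_⟩,
    fun φ => ⟨hint φ, rfl⟩⟩
  · rw [← integral_add (hint φ) (hint χ)]
    refine integral_congr_ae (Eventually.of_forall fun x => ?_)
    simp [mul_add]
  · rw [smul_eq_mul, ← integral_const_mul]
    refine integral_congr_ae (Eventually.of_forall fun x => ?_)
    simp [mul_left_comm]
  · have hlt := φ.2.2 (1 / (2 * (R + 1) * (d + 1))) (by positivity)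
    have h1 : ‖∫ x, Complex.exp (linForm z x) * starRingEnd ℂ ((φ : Rd d → ℂ) x)‖ ≤
        2 * (gsNorm t s (1 / (2 * (R + 1) * (d + 1))) (φ : Rd d → ℂ)).toReal * I := by
      refine norm_integral_mul_le_of_exp_bound (norm_cexp_linForm_le z) fun x => ?_
      rw [RCLike.norm_conj]
      exact exp_mul_norm_le_gsNorm ht.le ht1 hR hlt x
    change ‖∫ x, Complex.exp (linForm z x) * starRingEnd ℂ ((φ : Rd d → ℂ) x)‖ₑ ≤ _
    rw [← ofReal_norm, ← ENNReal.ofReal_toReal hlt.ne]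
    change _ ≤ ENNReal.ofReal (2 * I) * _
    rw [← ENNReal.ofReal_mul (by positivity)]
    refine ENNReal.ofReal_le_ofReal (h1.trans (le_of_eq (by ring)))

/-- An exponential is a character up to growth: translating the window by x only multiplies the
integral by e^{⟨x, z - iξ⟩}. The phase e^{-i⟨x, ξ⟩} drops out of the modulus, which separates x from
ξ. -/
theorem norm_stft_cexp_linForm {t s : ℝ} (ht : 0 < t) (hs : 0 < s) {z : Fin d → ℂ}
    {u : Ultradistribution d t s} (hu : u.IsFunction fun x => Complex.exp (linForm z x))
    (ψ : gelfandShilovSpace d t s) (x ξ : Rd d) :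
    ‖stft ht hs ψ u x ξ‖ = (2 * Real.pi) ^ (-(d : ℝ) / 2) * (‖Complex.exp (linForm z x)‖ *
      ‖laplace z (fun y => starRingEnd ℂ ((ψ : Rd d → ℂ) y)) ξ‖) := by
  have hpi : 0 < Real.pi := Real.pi_pos
  have h1 : u.pairing ⟨timeFreqShift x ξ (ψ : Rd d → ℂ), timeFreqShift_mem ht hs x ξ ψ.2⟩ =
      Complex.exp (linForm (freqShift z ξ) x) *
        laplace z (fun y => starRingEnd ℂ ((ψ : Rd d → ℂ) y)) ξ := by
    rw [(hu _).2, laplace, ← integral_const_mul, ← integral_add_right_eq_self _ x]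
    refine integral_congr_ae (Eventually.of_forall fun y => ?_)
    simp only [timeFreqShift, map_mul, ← Complex.exp_conj, Complex.conj_I, Complex.conj_ofReal,
      add_sub_cancel_right]
    rw [← mul_assoc, ← mul_assoc, ← Complex.exp_add, ← Complex.exp_add, ← map_add,
      linForm_freqShift, add_comm x y]
    congr 2
    ring
  have h2 : ‖Complex.exp (linForm (freqShift z ξ) x)‖ = ‖Complex.exp (linForm z x)‖ := by
    rw [Complex.norm_exp, Complex.norm_exp, linForm_freqShift]
    simp
  rw [stft, h1, norm_mul, norm_mul, h2, Complex.norm_real, Real.norm_of_nonneg (by positivity)]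

/-! ### The wave front set. -/

theorem contDiff_conj {f : Rd d → ℂ} (hf : ContDiff ℝ ∞ f) :
    ContDiff ℝ ∞ (fun y => starRingEnd ℂ (f y)) :=
  Complex.conjCLE.contDiff.comp hf

theorem NormBound.conj {t s : ℝ} {f : Rd d → ℂ} (H : NormBound t s f) :
    NormBound t s (fun y => starRingEnd ℂ (f y)) := by
  intro h hh
  obtain ⟨C, hC, hb⟩ := H h hh
  refine ⟨C, hC, fun k n x => ?_⟩
  rw [show (fun y => starRingEnd ℂ (f y)) = Complex.conjLIE ∘ f from rfl,
    LinearIsometryEquiv.norm_iteratedFDeriv_comp_left]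
  exact hb k n x

theorem waveFrontSet_cexp_linForm {t s : ℝ} (ht : 0 < t) (ht1 : t ≤ 1) (hs : 0 < s)
    {z : Fin d → ℂ} {u : Ultradistribution d t s}
    (hu : u.IsFunction fun x => Complex.exp (linForm z x))
    (ψ : gelfandShilovSpace d t s) (hψ : ψ ≠ 0) :
    waveFrontSet ht hs ψ u = {p : Rd d × Rd d | p.1 ≠ 0 ∧ p.2 = 0} := by
  have hpi : 0 < Real.pi := Real.pi_pos
  set χ : Rd d → ℂ := fun y => starRingEnd ℂ ((ψ : Rd d → ℂ) y) with hχ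
  have hχd : ContDiff ℝ ∞ χ := contDiff_conj ψ.2.1
  have hχb : NormBound t s χ := (normBound_of_gsNorm ht.le hs.le ψ.2.1 ψ.2.2).conj
  have hχ0 : χ ≠ 0 := by
    intro h0
    apply hψ
    ext y
    simpa [hχ] using congrFun h0 y
  set c : ℝ := (2 * Real.pi) ^ (-(d : ℝ) / 2) with hc
  have hc0 : 0 < c := by positivity
  have hV : ∀ x ξ, ‖stft ht hs ψ u x ξ‖ = c * (‖Complex.exp (linForm z x)‖ * ‖laplace z χ ξ‖) :=
    norm_stft_cexp_linForm ht hs hu ψ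
  set R : ℝ := ∑ j, |(z j).re| with hR
  have hR0 : 0 ≤ R := by positivity
  ext p
  constructor
  · rintro ⟨hp, hreg⟩
    suffices h2 : p.2 = 0 from ⟨fun h1 => hp (Prod.ext h1 h2), h2⟩
    by_contra h2
    apply hreg
    have hε : 0 < ‖p.2‖ / 2 := by have := norm_pos_iff.2 h2; positivity
    set ε := ‖p.2‖ / 2
    set K := ‖p.1‖ + 1 with hK
    have hK0 : 0 < K := by positivity
    -- Only boundedness of x and a lower bound on |ξ| matter, so a conic neighbourhood is not
    -- needed.
    refine ⟨{q | ‖q.1‖ < K ∧ ε < ‖q.2‖}, ?_, ?_, ?_, fun r hr => ?_⟩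
    · exact (isOpen_lt continuous_fst.norm continuous_const).inter
        (isOpen_lt continuous_const continuous_snd.norm)
    · simp [hε.le]
    · exact ⟨by simp [hK], half_lt_self (norm_pos_iff.2 h2)⟩
    -- As |λ^s ξ|^{1/s} ≥ λ ε^{1/s} on U, this rate gives decay e^{-(r + RK)λ}, which pays for both
    -- e^{rλ} and the growth in x.
    obtain ⟨C, hC, hb⟩ := exp_mul_norm_laplace_le ht1 hs hχd hχb z
      (r := (r + R * K) / ε ^ (1 / s)) (by positivity)
    refine ⟨c * Real.exp (R * K) * C, fun l hl q hq => ?_⟩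
    have h1 : ‖Complex.exp (linForm z (l ^ t • q.1))‖ ≤ Real.exp (R * K + R * K * l) := by
      refine (norm_cexp_linForm_le z _).trans (Real.exp_le_exp.2 ?_)
      -- For λ < 1 the power λ^t may exceed λ; the added 1 covers this case and costs only the
      -- factor e^{RK}.
      have hlt : l ^ t ≤ 1 + l := by
        rcases le_total l 1 with hl1 | hl1
        · exact (Real.rpow_le_one hl.le hl1 ht.le).trans (by linarith)
        · have := Real.rpow_le_rpow_of_exponent_le hl1 ht1
          rw [Real.rpow_one] at this
          linarith
      rw [norm_smul, Real.norm_of_nonneg (by positivity)]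
      calc R * (l ^ t * ‖q.1‖) ≤ R * ((1 + l) * K) := by gcongr; exact hq.1.le
        _ = _ := by ring
    have h3 : Real.exp ((r + R * K) * l) * ‖laplace z χ (l ^ s • q.2)‖ ≤ C := by
      refine le_trans ?_ (hb (l ^ s • q.2))
      refine mul_le_mul_of_nonneg_right (Real.exp_le_exp.2 ?_) (norm_nonneg _)
      rw [norm_smul, Real.norm_of_nonneg (by positivity),
        Real.mul_rpow (by positivity) (by positivity), ← Real.rpow_mul hl.le,
        mul_one_div_cancel hs.ne', Real.rpow_one, div_mul_eq_mul_div, le_div_iff₀ (by positivity),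
        mul_assoc]
      have : ε ^ (1 / s) ≤ ‖q.2‖ ^ (1 / s) := by gcongr; exact hq.2.le
      gcongr
    rw [hV]
    calc _ ≤ Real.exp (r * l) * (c * (Real.exp (R * K + R * K * l) *
          ‖laplace z χ (l ^ s • q.2)‖)) := by gcongr
      _ = c * Real.exp (R * K) * (Real.exp ((r + R * K) * l) *
          ‖laplace z χ (l ^ s • q.2)‖) := by
          rw [Real.exp_add, add_mul, Real.exp_add]; ring
      _ ≤ _ := by gcongr
  · rintro ⟨hp1, hp2⟩
    refine ⟨fun h => hp1 (by rw [h]; rfl), ?_⟩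
    rintro ⟨U, hU, -, hpU, hreg⟩
    obtain ⟨η, hη⟩ := exists_laplace_ne_zero ht1 hχd.continuous hχb z hχ0
    have hη0 : 0 < ‖laplace z χ η‖ := norm_pos_iff.2 hη
    -- The rate exceeds by one the possible decay e^{-R|x_0|λ} of the exponential, so a diverging
    -- factor e^λ survives.
    obtain ⟨C, hb⟩ := hreg (R * ‖p.1‖ + 1) (by positivity)
    -- The test point moves with λ: it enters U for large λ, while its scaled frequency λ^s λ^{-s} η
    -- stays at η.
    have hlim : Tendsto (fun l : ℝ => ((p.1, l ^ (-s) • η) : Rd d × Rd d)) atTop (𝓝 p) := by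
      have h1 : Tendsto (fun l : ℝ => l ^ (-s) • η) atTop (𝓝 ((0 : ℝ) • η)) :=
        (tendsto_rpow_neg_atTop hs).smul_const η
      rw [zero_smul, ← hp2] at h1
      exact (tendsto_const_nhds (x := p.1)).prodMk_nhds h1
    have hexp : Tendsto (fun l : ℝ => Real.exp l * (c * ‖laplace z χ η‖)) atTop atTop :=
      Real.tendsto_exp_atTop.atTop_mul_const (by positivity)
    obtain ⟨l, hlU, hl1, hlC⟩ := ((hlim.eventually (hU.mem_nhds hpU)).and
      ((eventually_ge_atTop (1 : ℝ)).and (hexp.eventually_gt_atTop C))).exists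
    have hl0 : 0 < l := by linarith
    have h1 := hb l hl0 _ hlU
    simp only [hV, smul_smul, ← Real.rpow_add hl0, add_neg_cancel, Real.rpow_zero, one_smul] at h1
    refine absurd (hlC.trans_le ?_) (lt_irrefl C)
    refine le_trans ?_ h1
    have h2 : Real.exp (-(R * ‖p.1‖ * l)) ≤ ‖Complex.exp (linForm z (l ^ t • p.1))‖ := by
      refine le_trans (Real.exp_le_exp.2 ?_) (exp_neg_le_norm_cexp_linForm z _)
      have hlt : l ^ t ≤ l := by
        simpa using Real.rpow_le_rpow_of_exponent_le hl1 ht1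
      rw [norm_smul, Real.norm_of_nonneg (by positivity)]
      refine neg_le_neg ?_
      calc R * (l ^ t * ‖p.1‖) ≤ R * (l * ‖p.1‖) := by gcongr
        _ = _ := by ring
    calc Real.exp l * (c * ‖laplace z χ η‖)
        = Real.exp ((R * ‖p.1‖ + 1) * l) * (c * (Real.exp (-(R * ‖p.1‖ * l)) *
          ‖laplace z χ η‖)) := by
          rw [show l = (R * ‖p.1‖ + 1) * l + -(R * ‖p.1‖ * l) by ring, Real.exp_add]
          ring_nf
      _ ≤ _ := by gcongr

end GelfandShilov

theorem proposition8p1 (d : ℕ) (t s : ℝ) (ht : 0 < t) (ht1 : t ≤ 1) (hs : 0 < s)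
    (hst : 1 < s + t) (z : EuclideanSpace ℂ (Fin d)) :
    (∃ u : GelfandShilov.Ultradistribution d t s,
      u.IsFunction fun x => Complex.exp (∑ j, (x j : ℂ) * z j)) ∧
    ∀ u : GelfandShilov.Ultradistribution d t s,
      (u.IsFunction fun x => Complex.exp (∑ j, (x j : ℂ) * z j)) →
        ∀ ψ : GelfandShilov.gelfandShilovSpace d t s, ψ ≠ 0 →
          GelfandShilov.waveFrontSet ht hs ψ u =
            {p : EuclideanSpace ℝ (Fin d) × EuclideanSpace ℝ (Fin d) | p.1 ≠ 0 ∧ p.2 = 0} := by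
  simp only [← GelfandShilov.linForm_apply (fun j => z j)]
  exact ⟨GelfandShilov.exists_isFunction_cexp_linForm s ht ht1 _, fun u hu ψ hψ =>
    GelfandShilov.waveFrontSet_cexp_linForm ht ht1 hs hu ψ hψ⟩
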